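/- Let $GA$ be the complex affine group, i.e. the complex Lie group of upper triangular $2\times 2$ complex matrices of determinant $1$, and let $G$ be a Hermitian metric on $GA$ that is invariant under all right translations $x\mapsto xk$, $k\in GA$. Let $(M,g)$ be a (finite-dimensional) Kähler manifold. Then there is no holomorphic immersion $\pi: GA\rightarrow M$ for which there exists a constant $C>0$ such that \[ \frac{1}{C}\,\pi^{*}g \;\leq\; G \;\leq\; C\,\pi^{*}g \] on $GA$, that is, $\frac1C\, g(d\pi_x u,d\pi_x u)\leq G_x(u,u)\leq C\, g(d\pi_x u,d\pi_x u)$ for all $x\in GA$ and all $u\in T_xGA$. -/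

import Mathlib

open scoped Manifold ContDiff Matrix

noncomputable section

/-! ### Hermitian and Kähler metrics on complex manifolds -/

/-- A (smooth) Hermitian metric on a complex manifold `M` modelled on the complex vector space `F`:
a positive definite Hermitian form `h_x` on every tangent space (conjugate-linear in the first and
linear in the second variable), whose coefficients in every chart of the atlas are smooth in the
real sense. -/
structure HermitianMetric (F : Type*) [NormedAddCommGroup F] [NormedSpace ℂ F]
    (M : Type*) [TopologicalSpace M] [ChartedSpace F M] where
  /-- the Hermitian form on the tangent space at `x` -/
  form : ∀ x : M, TangentSpace 𝓘(ℂ, F) x →L⋆[ℂ] TangentSpace 𝓘(ℂ, F) x →L[ℂ] ℂ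
  conj_symm : ∀ (x : M) (u v : TangentSpace 𝓘(ℂ, F) x),
    (starRingEnd ℂ) (form x u v) = form x v u
  pos : ∀ (x : M) (u : TangentSpace 𝓘(ℂ, F) x), u ≠ 0 → 0 < (form x u u).re
  smooth : ∀ e ∈ atlas F M, ∀ u v : F,
    ContDiffOn ℝ ∞ (fun z : F => form (e.symm z)
      (mfderiv 𝓘(ℂ, F) 𝓘(ℂ, F) e.symm z u) (mfderiv 𝓘(ℂ, F) 𝓘(ℂ, F) e.symm z v)) e.target

namespace HermitianMetric

/-- The associated Riemannian metric `g_x(u, v) = Re h_x(u, v)`. -/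
def realInner {F : Type*} [NormedAddCommGroup F] [NormedSpace ℂ F]
    {M : Type*} [TopologicalSpace M] [ChartedSpace F M] (h : HermitianMetric F M)
    (x : M) (u v : TangentSpace 𝓘(ℂ, F) x) : ℝ :=
  (h.form x u v).re

/-- The fundamental `(1,1)`-form of a Hermitian metric, as a real alternating `2`-form on each
tangent space: `ω_x(u, v) = Im h_x(u, v)`, that is `ω_x(u, v) = g_x(i u, v)` with `g = Re h`. -/
def fundamentalForm {F : Type*} [NormedAddCommGroup F] [NormedSpace ℂ F]
    {M : Type*} [TopologicalSpace M] [ChartedSpace F M] (h : HermitianMetric F M) (x : M) :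
    TangentSpace 𝓘(ℂ, F) x [⋀^Fin 2]→L[ℝ] ℝ where
  toFun w := (h.form x (w 0) (w 1)).im
  map_update_add' w i u v := by
    fin_cases i <;> simp
  map_update_smul' w i c u := by
    have hs : ∀ (c : ℝ) (u : TangentSpace 𝓘(ℂ, F) x), c • u = (c : ℂ) • u := fun _ _ => rfl
    fin_cases i
    · simp only [hs]
      simp [-Complex.coe_smul]
    · simp only [hs]
      simp [-Complex.coe_smul]
  cont := by
    let L : F →L⋆[ℂ] F →L[ℂ] ℂ := h.form x
    have hL : Continuous fun w : Fin 2 → F => (L (w 0) (w 1)).im :=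
      Complex.continuous_im.comp
        ((L.continuous.comp (continuous_apply 0)).clm_apply (continuous_apply 1))
    exact hL
  map_eq_zero_of_eq' w i j hij hne := by
    have key : ∀ u : TangentSpace 𝓘(ℂ, F) x, (h.form x u u).im = 0 := fun u =>
      Complex.conj_eq_iff_im.1 (h.conj_symm x u u)
    fin_cases i <;> fin_cases j <;> simp_all

/-- A Hermitian metric is Kähler if its fundamental form is closed, i.e. if the expression of the
fundamental form in every chart of the atlas has vanishing exterior derivative. -/
def IsKahler {F : Type*} [NormedAddCommGroup F] [NormedSpace ℂ F]
    {M : Type*} [TopologicalSpace M] [ChartedSpace F M] (h : HermitianMetric F M) : Prop :=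
  ∀ e ∈ atlas F M, ∀ z ∈ e.target,
    extDeriv (fun y : F => (h.fundamentalForm (e.symm y)).compContinuousLinearMap
      ((mfderiv 𝓘(ℂ, F) 𝓘(ℂ, F) e.symm y : F →L[ℂ] _).restrictScalars ℝ)) z = 0

end HermitianMetric

/-- A holomorphic immersion between complex manifolds: a holomorphic (complex analytic) map whose
differential is injective at every point. -/
def IsHolomorphicImmersion {E : Type*} [NormedAddCommGroup E] [NormedSpace ℂ E]
    {F : Type*} [NormedAddCommGroup F] [NormedSpace ℂ F]
    {N : Type*} [TopologicalSpace N] [ChartedSpace E N]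
    {M : Type*} [TopologicalSpace M] [ChartedSpace F M] (π : N → M) : Prop :=
  ContMDiff 𝓘(ℂ, E) 𝓘(ℂ, F) ω π ∧
    ∀ x : N, Function.Injective (mfderiv 𝓘(ℂ, E) 𝓘(ℂ, F) π x)

/-! ### The complex affine group -/

/-- The complex affine group: upper triangular complex `2 × 2` matrices of determinant `1`. -/
def affineSubgroup : Subgroup (Matrix.SpecialLinearGroup (Fin 2) ℂ) where
  carrier := {A | A 1 0 = 0}
  mul_mem' {A B} hA hB := by
    simp only [Set.mem_ofPred_eq] at hA hB ⊢
    simp [Matrix.mul_apply, Fin.sum_univ_two, hA, hB]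
  one_mem' := by simp
  inv_mem' {A} hA := by
    simp only [Set.mem_ofPred_eq] at hA ⊢
    simp [Matrix.SpecialLinearGroup.coe_inv, Matrix.adjugate_fin_two, hA]

/-- The complex affine group as a type, with its group structure and the topology induced from
matrices. -/
abbrev GA : Type := affineSubgroup

namespace GA

/-- The global coordinates `(a, b)` of the matrix with rows `(a, b)` and `(0, 1/a)`. -/
def coord (A : GA) : ℂ × ℂ := (A.1 0 0, A.1 0 1)

theorem lower_left (A : GA) : A.1 1 0 = 0 := A.2

theorem diag_mul (A : GA) : A.1 0 0 * A.1 1 1 = 1 := by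
  have h := A.1.det_coe
  rw [Matrix.det_fin_two, lower_left A] at h
  simpa using h

theorem continuous_val : Continuous fun A : GA => (A.1 : Matrix (Fin 2) (Fin 2) ℂ) :=
  Continuous.comp (g := fun A : Matrix.SpecialLinearGroup (Fin 2) ℂ => (A : Matrix (Fin 2) (Fin 2) ℂ))
    continuous_subtype_val continuous_subtype_val

/-- The matrix with rows `(a, b)` and `(0, 1/a)`, for `a ≠ 0`. -/
def ofCoord (p : {p : ℂ × ℂ // p.1 ≠ 0}) : GA :=
  ⟨⟨!![p.1.1, p.1.2; 0, p.1.1⁻¹], by simp [Matrix.det_fin_two, p.2]⟩, rfl⟩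

/-- The coordinates identify the affine group with `{(a, b) : a ≠ 0}`. -/
def coordHomeomorph : GA ≃ₜ {p : ℂ × ℂ // p.1 ≠ 0} where
  toFun A := ⟨coord A, left_ne_zero_of_mul_eq_one (diag_mul A)⟩
  invFun := ofCoord
  left_inv A := by
    apply Subtype.ext
    apply Subtype.ext
    ext i j
    fin_cases i <;> fin_cases j
    · rfl
    · rfl
    · exact (lower_left A).symm
    · exact inv_eq_of_mul_eq_one_right (diag_mul A)
  right_inv p := rfl
  continuous_toFun := by
    refine Continuous.subtype_mk (Continuous.prodMk ?_ ?_) _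
    · exact continuous_val.matrix_elem 0 0
    · exact continuous_val.matrix_elem 0 1
  continuous_invFun := by
    refine Continuous.subtype_mk (Continuous.subtype_mk (continuous_matrix fun i j => ?_) _) _
    fin_cases i <;> fin_cases j
    · exact continuous_fst.comp continuous_subtype_val
    · exact continuous_snd.comp continuous_subtype_val
    · exact continuous_const
    · exact (continuous_fst.comp continuous_subtype_val).inv₀ fun p => p.2

theorem isOpenEmbedding_coord : Topology.IsOpenEmbedding coord :=
  (IsOpen.isOpenEmbedding_subtypeVal (isOpen_ne_fun continuous_fst continuous_const)).comp
    coordHomeomorph.isOpenEmbedding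

/-- The complex structure of the affine group, given by the global coordinates `(a, b)`. -/
instance instChartedSpace : ChartedSpace (ℂ × ℂ) GA :=
  isOpenEmbedding_coord.singletonChartedSpace

instance instIsManifold : IsManifold 𝓘(ℂ, ℂ × ℂ) ω GA :=
  isOpenEmbedding_coord.isManifold_singleton

end GA

/-- A Hermitian metric on the affine group is right-invariant if all right translations
`x ↦ x * k` are isometries. -/
def HermitianMetric.IsRightInvariant (G : HermitianMetric (ℂ × ℂ) GA) : Prop :=
  ∀ (k x : GA) (u v : TangentSpace 𝓘(ℂ, ℂ × ℂ) x),
    G.form (x * k)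
      (mfderiv 𝓘(ℂ, ℂ × ℂ) 𝓘(ℂ, ℂ × ℂ) (fun y : GA => y * k) x u)
      (mfderiv 𝓘(ℂ, ℂ × ℂ) 𝓘(ℂ, ℂ × ℂ) (fun y : GA => y * k) x v) = G.form x u v

end

/-! By right-invariance, the length of a tangent vector of `GA` can be computed at the identity.
Consider the three-dimensional slice `a = exp u`, `b = exp u * (x + i y)`. Its `u`-curves are right
translates of the one-parameter subgroup `diag(exp u, exp (-u))`, so `∂_u` has constant length. At
fixed `u`, `∂_x` and `∂_y = i ∂_x` span a complex line, and each has squared length `exp (4u) * m`.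
All these lengths are independent of `x` and `y`.

Pull the Kähler form back to the slice. The result is a closed 2-form. On the planes `u = const` it
equals the squared `g`-length of the image of `∂_x`, by compatibility with `i`. Comparing metrics,
it is at least `exp (4U) m / C` on `u = U` and at most `C m` on `u = 0`. Stokes on `[0, U] × [0,
R]²` weighs these two faces, of area `R²`, against four side faces of area `U R` carrying bounded
integrands. Letting `R` grow gives `exp (4U) m / C ≤ C m` (`le_of_extDeriv_eq_zero_of_bounded`),
which is false for `4U = C²`. -/

noncomputable section

/-! ### Alternating forms and Stokes on a box -/

/-- A family of continuous alternating maps on a finite-dimensional space is differentiable as soon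
as all its evaluations are. -/
theorem differentiableAt_continuousAlternatingMap_of_apply
    {E F G : Type*} {ι : Type*} [Fintype ι]
    [NormedAddCommGroup E] [NormedSpace ℝ E]
    [NormedAddCommGroup F] [NormedSpace ℝ F] [FiniteDimensional ℝ F]
    [NormedAddCommGroup G] [NormedSpace ℝ G] [FiniteDimensional ℝ G]
    {η : E → F [⋀^ι]→L[ℝ] G} {z : E}
    (h : ∀ w : ι → F, DifferentiableAt ℝ (fun y => η y w) z) : DifferentiableAt ℝ η z := by
  classical
  let b := Module.finBasis ℝ F
  let L : (F [⋀^ι]→L[ℝ] G) →L[ℝ] ((ι → Fin (Module.finrank ℝ F)) → G) :=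
    ContinuousLinearMap.pi fun v => ContinuousAlternatingMap.apply ℝ F G (fun i => b (v i))
  -- An alternating map is determined by its values on tuples of basis vectors, so a linear left
  -- inverse of `L` recovers `η` from finitely many evaluations.
  have hL : Function.Injective L.toLinearMap := by
    intro α β hαβ
    apply ContinuousAlternatingMap.toAlternatingMap_injective
    exact Module.Basis.ext_alternating b fun v _ => congrFun hαβ v
  have : FiniteDimensional ℝ (F [⋀^ι]→L[ℝ] G) := FiniteDimensional.of_injective _ hL
  obtain ⟨K, hK⟩ := LinearMap.exists_leftInverse_of_injective _ (LinearMap.ker_eq_bot.2 hL)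
  have hη : η = fun y => LinearMap.toContinuousLinearMap K (L (η y)) := by
    funext y
    exact (LinearMap.congr_fun hK (η y)).symm
  rw [hη]
  refine (ContinuousLinearMap.differentiableAt _).comp z ?_
  exact differentiableAt_pi.2 fun v => h _

open MeasureTheory in
/-- **Stokes' theorem** on a box in `ℝⁿ⁺¹` for a closed `n`-form. -/
theorem sum_integral_faces_eq_zero_of_extDeriv_eq_zero {n : ℕ}
    {Ω : (Fin (n + 1) → ℝ) → (Fin (n + 1) → ℝ) [⋀^Fin n]→L[ℝ] ℝ}
    (hd : Differentiable ℝ Ω) (hc : ∀ p, extDeriv Ω p = 0) {a b : Fin (n + 1) → ℝ} (hab : a ≤ b) :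
    ∑ i : Fin (n + 1), ((-1 : ℝ) ^ i.val *
      ((∫ x in Set.Icc (a ∘ i.succAbove) (b ∘ i.succAbove),
        Ω (i.insertNth (b i) x) (fun j => Pi.single (i.succAbove j) 1)) -
      ∫ x in Set.Icc (a ∘ i.succAbove) (b ∘ i.succAbove),
        Ω (i.insertNth (a i) x) (fun j => Pi.single (i.succAbove j) 1))) = 0 := by
  let f : Fin (n + 1) → (Fin (n + 1) → ℝ) → ℝ := fun i p =>
    (-1 : ℝ) ^ i.val * Ω p (fun j => Pi.single (i.succAbove j) 1)
  have hΩ : ∀ w : Fin n → Fin (n + 1) → ℝ, Differentiable ℝ fun p => Ω p w := fun w p =>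
    (ContinuousAlternatingMap.apply ℝ (Fin (n + 1) → ℝ) ℝ w).differentiableAt.comp p (hd p)
  have hf : ∀ i, Differentiable ℝ (f i) := fun i => (hΩ _).const_mul _
  -- The divergence of the signed components is `extDeriv Ω` evaluated on the standard basis.
  have hdiv : ∀ p, ∑ i, fderiv ℝ (f i) p (Pi.single i 1) = 0 := by
    intro p
    have h := extDeriv_apply (hd p) (fun i : Fin (n + 1) => (Pi.single i 1 : Fin (n + 1) → ℝ))
    rw [hc p] at h
    rw [show (0 : (Fin (n + 1) → ℝ) [⋀^Fin (n + 1)]→L[ℝ] ℝ) (fun i => Pi.single i 1) = 0 from rfl] at h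
    rw [h]
    refine Finset.sum_congr rfl fun i _ => ?_
    simp only [f]
    rw [fderiv_const_mul (hΩ _ p)]
    rw [smul_apply, zsmul_eq_mul, smul_eq_mul]
    push_cast
    rfl
  have key := integral_divergence_of_hasFDerivAt_off_countable' a b hab f
    (fun i p => fderiv ℝ (f i) p) ∅ Set.countable_empty
    (fun i => (hf i).continuous.continuousOn) (fun p _ i => (hf i p).hasFDerivAt)
    (by simp only [hdiv]; exact integrableOn_zero)
  simp only [hdiv, integral_zero] at key
  rw [key]
  refine Finset.sum_congr rfl fun i _ => ?_
  simp only [f, integral_const_mul]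
  ring

/-! ### Pulling back the fundamental form -/

namespace HermitianMetric

variable {F : Type*} [NormedAddCommGroup F] [NormedSpace ℂ F]
  {M : Type*} [TopologicalSpace M] [ChartedSpace F M]

/-- The fundamental form read in a local parametrization `e : F → M`. -/
def localForm (g : HermitianMetric F M) (e : F → M) (y : F) : F [⋀^Fin 2]→L[ℝ] ℝ :=
  (g.fundamentalForm (e y)).compContinuousLinearMap
    ((mfderiv 𝓘(ℂ, F) 𝓘(ℂ, F) e y : F →L[ℂ] _).restrictScalars ℝ)

/-- The pullback of the fundamental form along the composition of a holomorphic map `f : E → M`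
with a real differentiable map `σ : X → E`. -/
def pullbackForm {E : Type*} [NormedAddCommGroup E] [NormedSpace ℂ E]
    {X : Type*} [NormedAddCommGroup X] [NormedSpace ℝ X]
    (g : HermitianMetric F M) (f : E → M) (σ : X → E) (p : X) : X [⋀^Fin 2]→L[ℝ] ℝ :=
  (g.fundamentalForm (f (σ p))).compContinuousLinearMap
    (((mfderiv 𝓘(ℂ, E) 𝓘(ℂ, F) f (σ p) : E →L[ℂ] _).restrictScalars ℝ).comp (fderiv ℝ σ p))

/-- The smoothness field of a metric only controls coefficients; this upgrades it to the form-valued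
map that `extDeriv_pullback` needs. -/
theorem differentiableAt_localForm [FiniteDimensional ℂ F] (g : HermitianMetric F M)
    {e : OpenPartialHomeomorph M F} (he : e ∈ atlas F M) {z : F} (hz : z ∈ e.target) :
    DifferentiableAt ℝ (g.localForm e.symm) z := by
  have : FiniteDimensional ℝ F := FiniteDimensional.complexToReal F
  refine differentiableAt_continuousAlternatingMap_of_apply fun w => ?_
  have h := ((g.smooth e he (w 0) (w 1)).contDiffAt (e.open_target.mem_nhds hz)).differentiableAt
    (by simp)
  exact Complex.imCLM.differentiableAt.comp z h

theorem extDeriv_localForm {g : HermitianMetric F M} (hg : g.IsKahler)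
    {e : OpenPartialHomeomorph M F} (he : e ∈ atlas F M) {z : F} (hz : z ∈ e.target) :
    extDeriv (g.localForm e.symm) z = 0 :=
  hg e he z hz

section Pullback

variable {E : Type*} [NormedAddCommGroup E] [NormedSpace ℂ E]
  {X : Type*} [NormedAddCommGroup X] [NormedSpace ℝ X]

theorem pullbackForm_apply (g : HermitianMetric F M) (f : E → M) (σ : X → E) (p : X)
    (w : Fin 2 → X) :
    g.pullbackForm f σ p w = (g.form (f (σ p))
      (mfderiv 𝓘(ℂ, E) 𝓘(ℂ, F) f (σ p) (fderiv ℝ σ p (w 0)))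
      (mfderiv 𝓘(ℂ, E) 𝓘(ℂ, F) f (σ p) (fderiv ℝ σ p (w 1)))).im :=
  rfl

/-- Transports along an equality of base points, whose tangent spaces are all modelled on `F`, where
a direct rewrite would meet dependent types. -/
theorem fundamentalForm_comp_congr (g : HermitianMetric F M) {x y : M} (h : x = y)
    {A B : X →L[ℝ] F} (hAB : A = B) :
    (g.fundamentalForm x).compContinuousLinearMap (A : X →L[ℝ] TangentSpace 𝓘(ℂ, F) x) =
      (g.fundamentalForm y).compContinuousLinearMap (B : X →L[ℝ] TangentSpace 𝓘(ℂ, F) y) := by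
  subst h hAB
  rfl

theorem restrictScalars_comp_eq {A : E →L[ℂ] F} {B : F →L[ℂ] F} {D : E →L[ℂ] F} {S : X →L[ℝ] E}
    {H : X →L[ℝ] F} (hA : A = B.comp D) (hH : H = (D.restrictScalars ℝ).comp S) :
    (A.restrictScalars ℝ).comp S = (B.restrictScalars ℝ).comp H := by
  subst hA hH
  rfl

variable [IsManifold 𝓘(ℂ, F) ω M]

/-- In a chart, the pullback of the fundamental form is the pullback of its local expression. -/
theorem eventually_pullbackForm_eq (g : HermitianMetric F M) {f : E → M} {σ : X → E} {p : X}
    {e : OpenPartialHomeomorph M F} (he : e ∈ atlas F M) (hp : f (σ p) ∈ e.source)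
    (hf : ContMDiffAt 𝓘(ℂ, E) 𝓘(ℂ, F) ω f (σ p)) (hσ : ContDiffAt ℝ ω σ p) :
    ∀ᶠ q in nhds p, g.pullbackForm f σ q =
      (g.localForm e.symm (e (f (σ q)))).compContinuousLinearMap
        (fderiv ℝ (fun q => e (f (σ q))) q) := by
  have : IsManifold 𝓘(ℂ, F) 1 M := IsManifold.of_le (n := ω) (by simp)
  have hsrc : ∀ᶠ z in nhds (σ p), f z ∈ e.source :=
    hf.continuousAt.preimage_mem_nhds (e.open_source.mem_nhds hp)
  have hf' : ∀ᶠ z in nhds (σ p), ContMDiffAt 𝓘(ℂ, E) 𝓘(ℂ, F) 1 f z :=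
    (contMDiffAt_iff_contMDiffAt_nhds (by simp)).1 (hf.of_le (by simp))
  have hσ' : ∀ᶠ q in nhds p, ContDiffAt ℝ 1 σ q :=
    (hσ.of_le (by simp)).eventually (by simp)
  filter_upwards [hσ.continuousAt.eventually hsrc.eventually_nhds, hσ.continuousAt.eventually hf',
    hσ'] with q hq hfq hσq
  have hq0 : f (σ q) ∈ e.source := hq.self_of_nhds
  have hed := mdifferentiable_of_mem_atlas (I := 𝓘(ℂ, F)) he
  have hfd : MDifferentiableAt 𝓘(ℂ, E) 𝓘(ℂ, F) f (σ q) := hfq.mdifferentiableAt (by simp)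
  have hefd : MDifferentiableAt 𝓘(ℂ, E) 𝓘(ℂ, F) (fun z => e (f z)) (σ q) :=
    (hed.mdifferentiableAt hq0).comp (σ q) hfd
  have hefd' : DifferentiableAt ℂ (fun z => e (f z)) (σ q) := hefd.differentiableAt
  have h1 : fderiv ℝ (fun q => e (f (σ q))) q =
      ((fderiv ℂ (fun z => e (f z)) (σ q)).restrictScalars ℝ).comp (fderiv ℝ σ q) :=
    ((hefd'.hasFDerivAt.restrictScalars ℝ).comp q
      (hσq.differentiableAt (by simp)).hasFDerivAt).fderiv
  have h2 : (mfderiv 𝓘(ℂ, E) 𝓘(ℂ, F) f (σ q) : E →L[ℂ] F) =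
      (mfderiv 𝓘(ℂ, F) 𝓘(ℂ, F) e.symm (e (f (σ q))) : F →L[ℂ] F).comp
        (fderiv ℂ (fun z => e (f z)) (σ q)) := by
    -- Near `σ q`, `f` factors through the chart, so the chain rule splits its differential.
    have h3 : f =ᶠ[nhds (σ q)] (e.symm ∘ fun z => e (f z)) :=
      hq.mono fun z hz => (e.left_inv hz).symm
    have h4 := h3.mfderiv_eq (I := 𝓘(ℂ, E)) (I' := 𝓘(ℂ, F))
    have h5 := mfderiv_comp (σ q) (hed.mdifferentiableAt_symm (e.map_source hq0)) hefd
    rw [mfderiv_eq_fderiv] at h5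
    exact h4.trans h5
  unfold pullbackForm localForm
  refine (fundamentalForm_comp_congr g (e.left_inv hq0).symm (B :=
    ((mfderiv 𝓘(ℂ, F) 𝓘(ℂ, F) e.symm (e (f (σ q))) : F →L[ℂ] F).restrictScalars ℝ).comp
      (fderiv ℝ (fun q => e (f (σ q))) q)) ?_).trans rfl
  exact restrictScalars_comp_eq (E := E) (F := F) h2 h1

theorem contDiffAt_chart_comp {f : E → M} {σ : X → E} {p : X}
    {e : OpenPartialHomeomorph M F} (he : e ∈ atlas F M) (hp : f (σ p) ∈ e.source)
    (hf : ContMDiffAt 𝓘(ℂ, E) 𝓘(ℂ, F) ω f (σ p)) (hσ : ContDiffAt ℝ ω σ p) :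
    ContDiffAt ℝ ω (fun q => e (f (σ q))) p := by
  have h1 : ContMDiffAt 𝓘(ℂ, E) 𝓘(ℂ, F) ω (fun z => e (f z)) (σ p) :=
    (contMDiffAt_of_mem_maximalAtlas (IsManifold.subset_maximalAtlas he) hp).comp (σ p) hf
  exact (h1.contDiffAt.restrict_scalars ℝ).comp p hσ

/-- The pullback of the fundamental form of a Hermitian metric is differentiable. -/
theorem differentiableAt_pullbackForm [FiniteDimensional ℂ F] (g : HermitianMetric F M)
    {f : E → M} {σ : X → E} {p : X}
    (hf : ContMDiffAt 𝓘(ℂ, E) 𝓘(ℂ, F) ω f (σ p)) (hσ : ContDiffAt ℝ ω σ p) :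
    DifferentiableAt ℝ (g.pullbackForm f σ) p := by
  have he := chart_mem_atlas F (f (σ p))
  have hp := mem_chart_source F (f (σ p))
  have hh := contDiffAt_chart_comp he hp hf hσ
  refine DifferentiableAt.congr_of_eventuallyEq ?_ (g.eventually_pullbackForm_eq he hp hf hσ)
  refine DifferentiableAt.continuousAlternatingMapCompContinuousLinearMap ?_ ?_
  · exact (g.differentiableAt_localForm he ((chartAt F (f (σ p))).map_source hp)).comp p
      (hh.differentiableAt (by simp))
  · exact (hh.fderiv_right (m := 1) (by simp)).differentiableAt (by simp)

/-- The pullback of the fundamental form of a Kähler metric is closed. -/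
theorem extDeriv_pullbackForm [FiniteDimensional ℂ F] {g : HermitianMetric F M} (hg : g.IsKahler)
    {f : E → M} {σ : X → E} {p : X}
    (hf : ContMDiffAt 𝓘(ℂ, E) 𝓘(ℂ, F) ω f (σ p)) (hσ : ContDiffAt ℝ ω σ p) :
    extDeriv (g.pullbackForm f σ) p = 0 := by
  have he := chart_mem_atlas F (f (σ p))
  have hp := mem_chart_source F (f (σ p))
  have ht := (chartAt F (f (σ p))).map_source hp
  have hh := contDiffAt_chart_comp he hp hf hσ
  rw [Filter.EventuallyEq.extDeriv_eq (g.eventually_pullbackForm_eq he hp hf hσ),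
    extDeriv_pullback (r := ω) (f := fun q => chartAt F (f (σ p)) (f (σ q)))
      (g.differentiableAt_localForm he ht) hh (by simp),
    extDeriv_localForm hg he ht]
  rfl

end Pullback

end HermitianMetric

/-! ### The affine group in coordinates -/

namespace GA

/-- The holomorphic parametrization of the affine group inverse to its coordinates. -/
def param : ℂ × ℂ → GA := (chartAt (ℂ × ℂ) (1 : GA)).symm

theorem mem_chart_target {z : ℂ × ℂ} (hz : z.1 ≠ 0) : z ∈ (chartAt (ℂ × ℂ) (1 : GA)).target := by
  change z ∈ (isOpenEmbedding_coord.toOpenPartialHomeomorph coord).target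
  rw [Topology.IsOpenEmbedding.toOpenPartialHomeomorph_target]
  exact ⟨ofCoord ⟨z, hz⟩, rfl⟩

theorem coord_param {z : ℂ × ℂ} (hz : z.1 ≠ 0) : coord (param z) = z :=
  (chartAt (ℂ × ℂ) (1 : GA)).right_inv (mem_chart_target hz)

theorem contMDiffAt_param {z : ℂ × ℂ} (hz : z.1 ≠ 0) :
    ContMDiffAt 𝓘(ℂ, ℂ × ℂ) 𝓘(ℂ, ℂ × ℂ) ω param z :=
  contMDiffAt_symm_of_mem_maximalAtlas (IsManifold.chart_mem_maximalAtlas (1 : GA)) (mem_chart_target hz)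

theorem mdifferentiableAt_param {z : ℂ × ℂ} (hz : z.1 ≠ 0) :
    MDifferentiableAt 𝓘(ℂ, ℂ × ℂ) 𝓘(ℂ, ℂ × ℂ) param z :=
  (contMDiffAt_param hz).mdifferentiableAt (by simp)

theorem mfderiv_param_injective {z : ℂ × ℂ} (hz : z.1 ≠ 0) :
    Function.Injective (mfderiv 𝓘(ℂ, ℂ × ℂ) 𝓘(ℂ, ℂ × ℂ) param z) := by
  have : IsManifold 𝓘(ℂ, ℂ × ℂ) 1 GA := IsManifold.of_le (n := ω) (by simp)
  have h := mdifferentiable_chart (I := 𝓘(ℂ, ℂ × ℂ)) (1 : GA)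
  exact h.symm.mfderiv_injective (mem_chart_target hz)

/-- Right translation by the group element with coordinates `k`, read in coordinates. -/
def rightMul (k : ℂ × ℂ) : ℂ × ℂ →L[ℂ] ℂ × ℂ :=
  (k.1 • ContinuousLinearMap.fst ℂ ℂ ℂ).prod
    (k.2 • ContinuousLinearMap.fst ℂ ℂ ℂ + k.1⁻¹ • ContinuousLinearMap.snd ℂ ℂ ℂ)

theorem rightMul_apply (k z : ℂ × ℂ) :
    rightMul k z = (k.1 * z.1, k.2 * z.1 + k.1⁻¹ * z.2) := rfl

theorem coord_mul (A B : GA) : coord (A * B) = rightMul (coord B) (coord A) := by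
  have h1 : ((A * B).1 : Matrix (Fin 2) (Fin 2) ℂ) = A.1.1 * B.1.1 := rfl
  have h2 : B.1 1 1 = (B.1 0 0)⁻¹ := (inv_eq_of_mul_eq_one_right (diag_mul B)).symm
  have h3 := lower_left B
  ext
  · simp [coord, rightMul_apply, Matrix.mul_apply, Fin.sum_univ_two, h3, mul_comm]
  · simp [coord, rightMul_apply, Matrix.mul_apply, Fin.sum_univ_two, h2, mul_comm]

theorem param_mul {z k : ℂ × ℂ} (hz : z.1 ≠ 0) (hk : k.1 ≠ 0) :
    param z * param k = param (rightMul k z) := by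
  have h : (rightMul k z).1 ≠ 0 := mul_ne_zero hk hz
  apply isOpenEmbedding_coord.injective
  rw [coord_mul, coord_param hz, coord_param hk, coord_param h]

end GA

/-! ### Right-invariant metrics in coordinates -/

namespace HermitianMetric

theorem form_congr {F : Type*} [NormedAddCommGroup F] [NormedSpace ℂ F]
    {M : Type*} [TopologicalSpace M] [ChartedSpace F M] (h : HermitianMetric F M) {x y : M}
    (hxy : x = y) (u v : F) :
    h.form x (u : TangentSpace 𝓘(ℂ, F) x) (v : TangentSpace 𝓘(ℂ, F) x) =
      h.form y (u : TangentSpace 𝓘(ℂ, F) y) (v : TangentSpace 𝓘(ℂ, F) y) := by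
  subst hxy
  rfl

/-- The squared length of a tangent vector of the affine group, in coordinates. -/
def coordNormSq (G : HermitianMetric (ℂ × ℂ) GA) (z w : ℂ × ℂ) : ℝ :=
  G.realInner (GA.param z) (mfderiv 𝓘(ℂ, ℂ × ℂ) 𝓘(ℂ, ℂ × ℂ) GA.param z w)
    (mfderiv 𝓘(ℂ, ℂ × ℂ) 𝓘(ℂ, ℂ × ℂ) GA.param z w)

variable {G : HermitianMetric (ℂ × ℂ) GA}

theorem coordNormSq_rightMul (hG : G.IsRightInvariant) {k z : ℂ × ℂ} (hk : k.1 ≠ 0) (hz : z.1 ≠ 0)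
    (w : ℂ × ℂ) : G.coordNormSq (GA.rightMul k z) (GA.rightMul k w) = G.coordNormSq z w := by
  have hkz : (GA.rightMul k z).1 ≠ 0 := mul_ne_zero hk hz
  have hmul : (fun y : GA => y * GA.param k) ∘ GA.param =ᶠ[nhds z] GA.param ∘ GA.rightMul k := by
    filter_upwards [(isOpen_ne_fun continuous_fst continuous_const).mem_nhds hz] with y hy
    exact GA.param_mul hy hk
  -- In the global coordinates a right translation is the restriction of a linear map.
  have hR : MDifferentiableAt 𝓘(ℂ, ℂ × ℂ) 𝓘(ℂ, ℂ × ℂ) (fun y : GA => y * GA.param k)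
      (GA.param z) := by
    have : IsManifold 𝓘(ℂ, ℂ × ℂ) 1 GA := IsManifold.of_le (n := ω) (by simp)
    have h : (fun y : GA => y * GA.param k) =
        GA.param ∘ GA.rightMul k ∘ chartAt (ℂ × ℂ) (1 : GA) := by
      funext y
      have hy : (GA.coord y).1 ≠ 0 := left_ne_zero_of_mul_eq_one (GA.diag_mul y)
      have hy' : GA.param (GA.coord y) = y :=
        GA.isOpenEmbedding_coord.injective (GA.coord_param hy)
      change y * GA.param k = GA.param (GA.rightMul k (GA.coord y))
      rw [← GA.param_mul hy hk, hy']
    have hc : chartAt (ℂ × ℂ) (1 : GA) (GA.param z) = z := GA.coord_param hz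
    rw [h]
    refine MDifferentiableAt.comp (I' := 𝓘(ℂ, ℂ × ℂ)) _ ?_ (MDifferentiableAt.comp (I' := 𝓘(ℂ, ℂ × ℂ)) _
      (GA.rightMul k).mdifferentiableAt (mdifferentiableAt_atlas (chart_mem_atlas _ _) ?_))
    · rw [Function.comp_apply, hc]
      exact GA.mdifferentiableAt_param hkz
    · exact (chartAt (ℂ × ℂ) (1 : GA)).map_target (GA.mem_chart_target hz)
  have h1 := mfderiv_comp z hR (GA.mdifferentiableAt_param hz)
  have h2 := mfderiv_comp z (I' := 𝓘(ℂ, ℂ × ℂ)) (GA.mdifferentiableAt_param hkz)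
    (GA.rightMul k).mdifferentiableAt
  rw [hmul.mfderiv_eq, h2] at h1
  have h3 := hG (GA.param k) (GA.param z) (mfderiv 𝓘(ℂ, ℂ × ℂ) 𝓘(ℂ, ℂ × ℂ) GA.param z w)
    (mfderiv 𝓘(ℂ, ℂ × ℂ) 𝓘(ℂ, ℂ × ℂ) GA.param z w)
  have h4 : (mfderiv 𝓘(ℂ, ℂ × ℂ) 𝓘(ℂ, ℂ × ℂ) (fun y : GA => y * GA.param k) (GA.param z)
      (mfderiv 𝓘(ℂ, ℂ × ℂ) 𝓘(ℂ, ℂ × ℂ) GA.param z w) : ℂ × ℂ) =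
      mfderiv 𝓘(ℂ, ℂ × ℂ) 𝓘(ℂ, ℂ × ℂ) GA.param (GA.rightMul k z) (GA.rightMul k w) := by
    have h5 := DFunLike.congr_fun h1 w
    rw [ContinuousLinearMap.mfderiv_eq] at h5
    exact h5.symm
  unfold coordNormSq realInner
  rw [← h3]
  congr 1
  refine (G.form_congr (GA.param_mul hz hk).symm _ _).trans ?_
  exact congrArg (fun u : ℂ × ℂ => G.form (GA.param z * GA.param k) u u) h4.symm

/-- Right translation by the inverse of the base point moves the vector to the identity. -/
theorem coordNormSq_eq (hG : G.IsRightInvariant) {z : ℂ × ℂ} (hz : z.1 ≠ 0) (w : ℂ × ℂ) :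
    G.coordNormSq z w = G.coordNormSq (1, 0) (w.1 / z.1, z.1 * w.2 - z.2 * w.1) := by
  -- `(z.1⁻¹, -z.2)` are the coordinates of the inverse matrix.
  rw [← coordNormSq_rightMul hG (k := (z.1⁻¹, -z.2)) (inv_ne_zero hz) hz w]
  congr 1
  · ext
    · simp [GA.rightMul_apply, hz]
    · simp [GA.rightMul_apply]
      ring
  · ext
    · simp [GA.rightMul_apply, div_eq_inv_mul]
    · simp [GA.rightMul_apply]
      ring

theorem coordNormSq_pos (G : HermitianMetric (ℂ × ℂ) GA) {z w : ℂ × ℂ} (hz : z.1 ≠ 0)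
    (hw : w ≠ 0) : 0 < G.coordNormSq z w := by
  refine G.pos _ _ fun h => hw ?_
  apply GA.mfderiv_param_injective hz
  rw [h]
  exact (map_zero _).symm

theorem coordNormSq_smul (G : HermitianMetric (ℂ × ℂ) GA) (z w : ℂ × ℂ) (c : ℂ) :
    G.coordNormSq z (c • w) = ‖c‖ ^ 2 * G.coordNormSq z w := by
  unfold coordNormSq realInner
  have h : mfderiv 𝓘(ℂ, ℂ × ℂ) 𝓘(ℂ, ℂ × ℂ) GA.param z (c • w : ℂ × ℂ) =
      c • mfderiv 𝓘(ℂ, ℂ × ℂ) 𝓘(ℂ, ℂ × ℂ) GA.param z w := map_smul _ _ _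
  rw [h]
  simp only [map_smulₛₗ, smul_apply, smul_eq_mul, RingHom.id_apply]
  rw [← mul_assoc, Complex.mul_conj', ← Complex.ofReal_pow, Complex.re_ofReal_mul]

end HermitianMetric

/-! ### The growth estimate from Stokes -/

open MeasureTheory in
/-- A closed `2`-form on `[0, U] × ℝ²` whose components in the first direction are bounded cannot
be larger on the slice at `U` than on the slice at `0`. -/
theorem le_of_extDeriv_eq_zero_of_bounded
    {Ω : (Fin 3 → ℝ) → (Fin 3 → ℝ) [⋀^Fin 2]→L[ℝ] ℝ}
    (hd : Differentiable ℝ Ω) (hc : ∀ p, extDeriv Ω p = 0) {U K α β : ℝ} (hU : 0 ≤ U)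
    (hα : ∀ p : Fin 3 → ℝ, p 0 = U → α ≤ Ω p fun j => Pi.single ((0 : Fin 3).succAbove j) 1)
    (hβ : ∀ p : Fin 3 → ℝ, p 0 = 0 → Ω p (fun j => Pi.single ((0 : Fin 3).succAbove j) 1) ≤ β)
    (hK : ∀ p : Fin 3 → ℝ, 0 ≤ p 0 → p 0 ≤ U → ∀ i : Fin 3, i ≠ 0 →
      |Ω p fun j => Pi.single (i.succAbove j) 1| ≤ K) : α ≤ β := by
  have hcont : ∀ w : Fin 2 → Fin 3 → ℝ, Continuous fun p => Ω p w := fun w =>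
    (ContinuousAlternatingMap.apply ℝ (Fin 3 → ℝ) ℝ w).continuous.comp hd.continuous
  have hint : ∀ (w : Fin 2 → Fin 3 → ℝ) (i : Fin 3) (t : ℝ) (c d : Fin 2 → ℝ),
      IntegrableOn (fun x : Fin 2 → ℝ => Ω (i.insertNth t x) w) (Set.Icc c d) := fun w i t c d =>
    ((hcont w).comp (by fun_prop)).continuousOn.integrableOn_compact isCompact_Icc
  -- Four side faces of area `U * R` against two faces of area `R * R`; one factor `R` is cancelled
  -- at the end.
  have key : ∀ R : ℝ, 0 < R → (α - β) * R ≤ 4 * (U * K) := by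
    intro R hR
    let b : Fin 3 → ℝ := ![U, R, R]
    have hb : (0 : Fin 3 → ℝ) ≤ b := by
      intro i
      fin_cases i <;> simp [b, hU, hR.le]
    have hvol : ∀ i : Fin 3,
        volume.real (Set.Icc ((0 : Fin 3 → ℝ) ∘ i.succAbove) (b ∘ i.succAbove)) =
          ∏ j, b (i.succAbove j) := by
      intro i
      rw [measureReal_def, Real.volume_Icc_pi_toReal
        (a := (0 : Fin 3 → ℝ) ∘ i.succAbove) (b := b ∘ i.succAbove) (fun j => hb _)]
      simp
    have hv0 : volume.real (Set.Icc ((0 : Fin 3 → ℝ) ∘ (0 : Fin 3).succAbove)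
        (b ∘ (0 : Fin 3).succAbove)) = R * R := by
      rw [hvol]; simp [Fin.prod_univ_two, b]
    have hside : ∀ i : Fin 3, i ≠ 0 →
        volume.real (Set.Icc ((0 : Fin 3 → ℝ) ∘ i.succAbove) (b ∘ i.succAbove)) = U * R := by
      intro i hi
      rw [hvol]
      fin_cases i
      · exact absurd rfl hi
      · simp [Fin.prod_univ_two, b, Fin.succAbove]
      · simp [Fin.prod_univ_two, b, Fin.succAbove]
    have hbound : ∀ (i : Fin 3), i ≠ 0 → ∀ t : ℝ,
        |∫ x in Set.Icc ((0 : Fin 3 → ℝ) ∘ i.succAbove) (b ∘ i.succAbove),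
          Ω (i.insertNth t x) (fun j => Pi.single (i.succAbove j) 1)| ≤ K * (U * R) := by
      intro i hi t
      rw [← hside i hi, ← Real.norm_eq_abs]
      refine norm_setIntegral_le_of_norm_le_const isCompact_Icc.measure_lt_top fun x hx => ?_
      -- On a face with `i ≠ 0`, coordinate `0` is one of the integration variables, so it stays in
      -- `[0, U]` and `hK` applies.
      obtain ⟨j, hj⟩ := Fin.exists_succAbove_eq hi.symm
      have hx0 : (i.insertNth t x : Fin 3 → ℝ) 0 = x j := by
        rw [← hj]
        exact Fin.insertNth_apply_succAbove (α := fun _ => ℝ) i t x j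
      have h1 := hx.1 j
      have h2 := hx.2 j
      simp only [Function.comp_apply, hj] at h1 h2
      exact hK _ (by rw [hx0]; exact h1) (by rw [hx0]; exact h2) i hi
    have hstokes := sum_integral_faces_eq_zero_of_extDeriv_eq_zero hd hc hb
    rw [Fin.sum_univ_three] at hstokes
    have htop : α * (R * R) ≤ ∫ x in Set.Icc ((0 : Fin 3 → ℝ) ∘ (0 : Fin 3).succAbove)
        (b ∘ (0 : Fin 3).succAbove),
        Ω ((0 : Fin 3).insertNth (b 0) x) (fun j => Pi.single ((0 : Fin 3).succAbove j) 1) := by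
      have := setIntegral_mono_on (integrableOn_const isCompact_Icc.measure_lt_top.ne)
        (hint (fun j => Pi.single ((0 : Fin 3).succAbove j) 1) 0 (b 0) _ _) measurableSet_Icc
        (fun x (_ : x ∈ Set.Icc ((0 : Fin 3 → ℝ) ∘ (0 : Fin 3).succAbove)
          (b ∘ (0 : Fin 3).succAbove)) => hα _ (Fin.insertNth_apply_same (α := fun _ => ℝ) 0 (b 0) x))
      rwa [setIntegral_const, hv0, smul_eq_mul, mul_comm] at this
    have hbot : ∫ x in Set.Icc ((0 : Fin 3 → ℝ) ∘ (0 : Fin 3).succAbove)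
        (b ∘ (0 : Fin 3).succAbove), Ω ((0 : Fin 3).insertNth ((0 : Fin 3 → ℝ) 0) x)
          (fun j => Pi.single ((0 : Fin 3).succAbove j) 1) ≤ β * (R * R) := by
      have := setIntegral_mono_on
        (hint (fun j => Pi.single ((0 : Fin 3).succAbove j) 1) 0 ((0 : Fin 3 → ℝ) 0) _ _)
        (integrableOn_const isCompact_Icc.measure_lt_top.ne) measurableSet_Icc
        (fun x (_ : x ∈ Set.Icc ((0 : Fin 3 → ℝ) ∘ (0 : Fin 3).succAbove)
          (b ∘ (0 : Fin 3).succAbove)) =>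
            hβ _ (Fin.insertNth_apply_same (α := fun _ => ℝ) 0 ((0 : Fin 3 → ℝ) 0) x))
      rwa [setIntegral_const, hv0, smul_eq_mul, mul_comm (R * R)] at this
    have h1a := abs_le.1 (hbound 1 (by decide) (b 1))
    have h1b := abs_le.1 (hbound 1 (by decide) ((0 : Fin 3 → ℝ) 1))
    have h2a := abs_le.1 (hbound 2 (by decide) (b 2))
    have h2b := abs_le.1 (hbound 2 (by decide) ((0 : Fin 3 → ℝ) 2))
    simp only [Fin.val_zero, Fin.val_one, Fin.val_two, pow_zero, pow_one, one_mul, neg_mul,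
      neg_one_sq] at hstokes
    refine le_of_mul_le_mul_right ?_ hR
    linarith [h1a.1, h1a.2, h1b.1, h1b.2, h2a.1, h2a.2, h2b.1, h2b.2]
  by_contra! hlt
  have hpos : 0 < α - β := sub_pos.2 hlt
  -- This `R` makes the left side `4 * |U * K| + 1`, which exceeds `4 * (U * K)`.
  have h := key ((4 * |U * K| + 1) / (α - β)) (by positivity)
  rw [mul_div_cancel₀ _ hpos.ne'] at h
  linarith [le_abs_self (U * K)]

/-! ### Positivity estimates for the fundamental form -/

namespace HermitianMetric

section Positivity

variable {F : Type*} [NormedAddCommGroup F] [NormedSpace ℂ F]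
  {M : Type*} [TopologicalSpace M] [ChartedSpace F M]

theorem realInner_self_nonneg (h : HermitianMetric F M) (x : M) (u : TangentSpace 𝓘(ℂ, F) x) :
    0 ≤ h.realInner x u u := by
  by_cases hu : u = 0
  · simp [realInner, hu]
  · exact (h.pos x u hu).le

/-- Positivity at `u ± i v` gives `2 |Im h(u, v)| ≤ h(u, u) + h(v, v)`. This cheap substitute for
Cauchy–Schwarz suffices to bound the side faces. -/
theorem abs_form_im_le (h : HermitianMetric F M) (x : M) (u v : TangentSpace 𝓘(ℂ, F) x) :
    |(h.form x u v).im| ≤ h.realInner x u u + h.realInner x v v := by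
  have hu := h.realInner_self_nonneg x u
  have hv := h.realInner_self_nonneg x v
  have h1 := h.realInner_self_nonneg x (u + Complex.I • v)
  have h2 := h.realInner_self_nonneg x (u - Complex.I • v)
  have hs := h.conj_symm x u v
  simp only [realInner, map_add, map_sub, add_apply, sub_apply, map_smulₛₗ, smul_apply, smul_eq_mul,
    RingHom.id_apply, Complex.conj_I, ← hs, Complex.add_re, Complex.sub_re, Complex.mul_re,
    Complex.mul_im, Complex.add_im, Complex.sub_im, Complex.I_re, Complex.I_im, Complex.conj_re,
    Complex.conj_im, Complex.neg_re, Complex.neg_im] at hu hv h1 h2 ⊢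
  rw [abs_le]
  constructor <;> linarith

/-- On a complex line the fundamental form is the Riemannian area; this yields the lower bound on
the top face. -/
theorem form_smul_I_im (h : HermitianMetric F M) (x : M) (u : TangentSpace 𝓘(ℂ, F) x) :
    (h.form x u (Complex.I • u)).im = h.realInner x u u := by
  simp [realInner]

end Positivity

end HermitianMetric

/-! ### The slice and the lengths of its coordinate fields -/

namespace GA

/-- A real three-dimensional slice of the affine group: `a = exp u`, `b = exp u * (x + i y)`. -/
def slice (p : Fin 3 → ℝ) : ℂ × ℂ :=
  (Complex.exp (p 0), Complex.exp (p 0) * (p 1 + Complex.I * p 2))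

theorem slice_fst_ne_zero (p : Fin 3 → ℝ) : (slice p).1 ≠ 0 := Complex.exp_ne_zero _

theorem contDiff_slice : ContDiff ℝ ω slice := by
  have h : ∀ i : Fin 3, ContDiff ℝ ω fun p : Fin 3 → ℝ => (p i : ℂ) := fun i =>
    (Complex.ofRealCLM.comp (ContinuousLinearMap.proj (R := ℝ) (φ := fun _ : Fin 3 => ℝ) i)).contDiff
  have he := ((Complex.contDiff_exp (𝕜 := ℝ) (n := ω))).comp (h 0)
  exact he.prodMk (he.mul ((h 1).add (contDiff_const.mul (h 2))))

theorem fderiv_slice (p v : Fin 3 → ℝ) :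
    fderiv ℝ slice p v = (Complex.exp (p 0) * v 0,
      Complex.exp (p 0) * v 0 * (p 1 + Complex.I * p 2) +
        Complex.exp (p 0) * (v 1 + Complex.I * v 2)) := by
  have h : ∀ i : Fin 3, HasFDerivAt (fun p : Fin 3 → ℝ => (p i : ℂ))
      (Complex.ofRealCLM.comp (ContinuousLinearMap.proj (R := ℝ) (φ := fun _ : Fin 3 => ℝ) i)) p :=
    fun i => (Complex.ofRealCLM.comp
      (ContinuousLinearMap.proj (R := ℝ) (φ := fun _ : Fin 3 => ℝ) i)).hasFDerivAt
  have he := (h 0).cexp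
  have hs := he.prodMk (he.mul ((h 1).add ((h 2).const_mul Complex.I)))
  have hs' : fderiv ℝ slice p = _ := hs.fderiv
  rw [hs']
  ext
  · simp
  · simp
    ring

end GA

namespace HermitianMetric

variable {G : HermitianMetric (ℂ × ℂ) GA}

/-- Moved to the identity, the vector becomes `(0, exp (2u) * c)`; squaring its length produces the
exponent `4u`. -/
theorem coordNormSq_slice_vertical (hG : G.IsRightInvariant) (p : Fin 3 → ℝ) (c : ℂ) :
    G.coordNormSq (GA.slice p) (0, Complex.exp (p 0) * c) =
      Real.exp (4 * p 0) * ‖c‖ ^ 2 * G.coordNormSq (1, 0) (0, 1) := by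
  have h : ((0, Complex.exp (p 0) * c) : ℂ × ℂ).1 / (GA.slice p).1 = 0 := by simp
  have h' : (GA.slice p).1 * ((0, Complex.exp (p 0) * c) : ℂ × ℂ).2 -
      (GA.slice p).2 * ((0, Complex.exp (p 0) * c) : ℂ × ℂ).1 =
      Complex.exp (p 0) * Complex.exp (p 0) * c := by
    simp [GA.slice]
    ring
  have h2 : ((0, Complex.exp (p 0) * Complex.exp (p 0) * c) : ℂ × ℂ) =
      (Complex.exp (p 0) * Complex.exp (p 0) * c) • ((0, 1) : ℂ × ℂ) := by simp
  rw [coordNormSq_eq hG (GA.slice_fst_ne_zero p), h, h', h2, coordNormSq_smul, norm_mul, norm_mul,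
    Complex.norm_exp, Complex.ofReal_re, ← Real.exp_add, mul_pow, ← Real.exp_nat_mul]
  congr 3
  push_cast
  ring

/-- The field `∂_u` at a point equals the coordinate vector of that point, which right translation
takes to `(1, 0)` at the identity. -/
theorem coordNormSq_slice_radial (hG : G.IsRightInvariant) (p : Fin 3 → ℝ) :
    G.coordNormSq (GA.slice p) (GA.slice p) = G.coordNormSq (1, 0) (1, 0) := by
  rw [coordNormSq_eq hG (GA.slice_fst_ne_zero p), div_self (GA.slice_fst_ne_zero p), mul_comm,
    sub_self]

end HermitianMetric

end

/-! ### The contradiction -/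

theorem mainTheorem10 {F : Type*} [NormedAddCommGroup F] [NormedSpace ℂ F] [FiniteDimensional ℂ F]
    {M : Type*} [TopologicalSpace M] [ChartedSpace F M] [IsManifold 𝓘(ℂ, F) ω M]
    (g : HermitianMetric F M) (hg : g.IsKahler)
    (G : HermitianMetric (ℂ × ℂ) GA) (hG : G.IsRightInvariant) :
    ¬ ∃ π : GA → M, IsHolomorphicImmersion (E := ℂ × ℂ) (F := F) π ∧
      ∃ C : ℝ, 0 < C ∧ ∀ (x : GA) (u : TangentSpace 𝓘(ℂ, ℂ × ℂ) x),
        (1 / C) * g.realInner (π x) (mfderiv 𝓘(ℂ, ℂ × ℂ) 𝓘(ℂ, F) π x u)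
            (mfderiv 𝓘(ℂ, ℂ × ℂ) 𝓘(ℂ, F) π x u) ≤ G.realInner x u u ∧
        G.realInner x u u ≤ C * g.realInner (π x) (mfderiv 𝓘(ℂ, ℂ × ℂ) 𝓘(ℂ, F) π x u)
            (mfderiv 𝓘(ℂ, ℂ × ℂ) 𝓘(ℂ, F) π x u) := by
  rintro ⟨π, ⟨hπ, -⟩, C, hC, hπG⟩
  let f : ℂ × ℂ → M := π ∘ GA.param
  let A : (Fin 3 → ℝ) → ℂ × ℂ → ℝ := fun p w => g.realInner (f (GA.slice p))
    (mfderiv 𝓘(ℂ, ℂ × ℂ) 𝓘(ℂ, F) f (GA.slice p) w) (mfderiv 𝓘(ℂ, ℂ × ℂ) 𝓘(ℂ, F) f (GA.slice p) w)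
  have hA : ∀ p w, A p w ≤ C * G.coordNormSq (GA.slice p) w ∧
      G.coordNormSq (GA.slice p) w ≤ C * A p w := by
    intro p w
    have hcomp := mfderiv_comp (GA.slice p) (hπ.contMDiffAt.mdifferentiableAt (by simp))
      (GA.mdifferentiableAt_param (GA.slice_fst_ne_zero p))
    have h := hπG (GA.param (GA.slice p))
      (mfderiv 𝓘(ℂ, ℂ × ℂ) 𝓘(ℂ, ℂ × ℂ) GA.param (GA.slice p) w)
    have hA' : A p w = g.realInner (π (GA.param (GA.slice p)))
        (mfderiv 𝓘(ℂ, ℂ × ℂ) 𝓘(ℂ, F) π (GA.param (GA.slice p))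
          (mfderiv 𝓘(ℂ, ℂ × ℂ) 𝓘(ℂ, ℂ × ℂ) GA.param (GA.slice p) w))
        (mfderiv 𝓘(ℂ, ℂ × ℂ) 𝓘(ℂ, F) π (GA.param (GA.slice p))
          (mfderiv 𝓘(ℂ, ℂ × ℂ) 𝓘(ℂ, ℂ × ℂ) GA.param (GA.slice p) w)) := by
      simp only [A, f]
      rw [hcomp]
      rfl
    rw [← hA'] at h
    refine ⟨?_, h.2⟩
    have h1 := h.1
    rwa [one_div, inv_mul_le_iff₀ hC] at h1
  have hf : ∀ p, ContMDiffAt 𝓘(ℂ, ℂ × ℂ) 𝓘(ℂ, F) ω f (GA.slice p) := fun p =>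
    hπ.contMDiffAt.comp _ (GA.contMDiffAt_param (GA.slice_fst_ne_zero p))
  set m := G.coordNormSq (1, 0) (0, 1) with hm
  set n := G.coordNormSq (1, 0) (1, 0) with hn
  have hmpos : 0 < m := G.coordNormSq_pos (by simp) (by simp)
  have hd0 : ∀ p, fderiv ℝ GA.slice p (Pi.single 0 1) = GA.slice p := fun p => by
    rw [GA.fderiv_slice]
    simp [GA.slice]
  have hd1 : ∀ p, fderiv ℝ GA.slice p (Pi.single 1 1) = (0, Complex.exp (p 0) * 1) := fun p => by
    rw [GA.fderiv_slice]
    simp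
  have hd2 : ∀ p, fderiv ℝ GA.slice p (Pi.single 2 1) = (0, Complex.exp (p 0) * Complex.I) :=
    fun p => by
      rw [GA.fderiv_slice]
      simp
  have hN0 : ∀ p, G.coordNormSq (GA.slice p) (fderiv ℝ GA.slice p (Pi.single 0 1)) = n :=
    fun p => by rw [hd0, HermitianMetric.coordNormSq_slice_radial hG]
  have hN1 : ∀ p, G.coordNormSq (GA.slice p) (fderiv ℝ GA.slice p (Pi.single 1 1)) =
      Real.exp (4 * p 0) * m :=
    fun p => by rw [hd1, HermitianMetric.coordNormSq_slice_vertical hG]; simp [hm]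
  have hN2 : ∀ p, G.coordNormSq (GA.slice p) (fderiv ℝ GA.slice p (Pi.single 2 1)) =
      Real.exp (4 * p 0) * m :=
    fun p => by rw [hd2, HermitianMetric.coordNormSq_slice_vertical hG]; simp [hm]
  have hvert : ∀ p, g.pullbackForm f GA.slice p
      (fun j => Pi.single ((0 : Fin 3).succAbove j) 1) =
        A p (fderiv ℝ GA.slice p (Pi.single 1 1)) := by
    intro p
    -- `∂_y = i ∂_x`, and the differential of `f` is complex linear, so the images also span a
    -- complex line.
    have hI : fderiv ℝ GA.slice p (Pi.single 2 1) =
        Complex.I • fderiv ℝ GA.slice p (Pi.single 1 1) := by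
      rw [hd1, hd2]
      simp [mul_comm]
    have hI' : mfderiv 𝓘(ℂ, ℂ × ℂ) 𝓘(ℂ, F) f (GA.slice p)
        (fderiv ℝ GA.slice p (Pi.single 2 1)) = Complex.I • mfderiv 𝓘(ℂ, ℂ × ℂ) 𝓘(ℂ, F) f
          (GA.slice p) (fderiv ℝ GA.slice p (Pi.single 1 1)) := by
      rw [hI]
      exact map_smul _ _ _
    rw [HermitianMetric.pullbackForm_apply]
    refine Eq.trans ?_ (g.form_smul_I_im _ _)
    rw [← hI']
    rfl
  -- `U = C ^ 2 / 4` turns the growth factor `exp (4U)` into `exp (C ^ 2)`, which beats the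
  -- distortion `C ^ 2`. `K` adds the bounds for the squared lengths of `∂_u` and of `∂_x` or `∂_y`
  -- over `0 ≤ u ≤ U`.
  have hle := le_of_extDeriv_eq_zero_of_bounded (Ω := g.pullbackForm f GA.slice)
    (U := C ^ 2 / 4) (K := C * (n + Real.exp (C ^ 2) * m)) (α := Real.exp (C ^ 2) * m / C)
    (β := C * m)
    (fun p => g.differentiableAt_pullbackForm (hf p) GA.contDiff_slice.contDiffAt)
    (fun p => HermitianMetric.extDeriv_pullbackForm hg (hf p) GA.contDiff_slice.contDiffAt)
    (by positivity)
    (fun p hp => by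
      have h := (hA p (fderiv ℝ GA.slice p (Pi.single 1 1))).2
      rw [hN1, hp, mul_div_cancel₀ _ (by norm_num)] at h
      rwa [hvert, div_le_iff₀' hC])
    (fun p hp => by
      have h := (hA p (fderiv ℝ GA.slice p (Pi.single 1 1))).1
      rw [hN1, hp, mul_zero, Real.exp_zero, one_mul] at h
      rwa [hvert])
    (fun p _ hpU i hi => by
      have hexp : Real.exp (4 * p 0) * m ≤ Real.exp (C ^ 2) * m := by
        gcongr
        linarith
      have h0 := (hA p (fderiv ℝ GA.slice p (Pi.single 0 1))).1
      rw [hN0] at h0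
      have hw : ∀ w : Fin 3 → ℝ, G.coordNormSq (GA.slice p) (fderiv ℝ GA.slice p w) =
          Real.exp (4 * p 0) * m → A p (fderiv ℝ GA.slice p w) ≤ C * (Real.exp (C ^ 2) * m) := by
        intro w hw
        refine (hA p _).1.trans ?_
        rw [hw]
        gcongr
      rw [HermitianMetric.pullbackForm_apply, mul_add]
      refine (g.abs_form_im_le _ _ _).trans ?_
      fin_cases i
      · exact absurd rfl hi
      · exact add_le_add h0 (hw _ (hN2 p))
      · exact add_le_add h0 (hw _ (hN1 p)))
  rw [div_le_iff₀ hC] at hle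
  have h1 : Real.exp (C ^ 2) * m ≤ C ^ 2 * m := by linarith
  have h2 := le_of_mul_le_mul_right h1 hmpos
  linarith [Real.add_one_le_exp (C ^ 2)]
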